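/- **Theorem 1 (Rate of Convergence).** For each $n\ge 1$ let $x_{1},\dots,x_{n}$ (possibly depending on $n$) be fixed design points in a set $\mathcal X$ with empirical measure $Q_n$, put $\|g\|_n^2=\frac1n\sum_{i=1}^n g(x_i)^2$, and observe $y_i=f^*(x_i)+w_i$, $i\le n$. Let $\mathcal F$ be a cone of functions $\mathcal X\to\mathbb R$ (closed under multiplication by positive scalars) with $f^*\in\mathcal F$, and let $0<\alpha<2$. Let $P\ge 0$ be a penalty on $\mathcal F$ with $P(tf)=t^{v}P(f)$ for all $t>0$, $f\in\mathcal F$, where $v>\frac{2\alpha}{2+\alpha}$; for example a Sobolev penalty $P(f)=\int|f^{(r+1)}|^{\ell}$, with $v=\ell$. Let $N(\delta,\mathcal G,Q_n)$ be the least number of $L_2(Q_n)$-balls of radius $\delta$ covering $\mathcal G$, $H=\log N$, and assume that for a constant $c>0$ $$H\bigl(\delta,\{f\in\mathcal F:P(f)\le 1\},Q_n\bigr)\le c\,\delta^{-\alpha}\qquad\text{for all }\delta>0,\ n\ge 1 .$$ Assume that for each $n$ the errors $w_1,\dots,w_n$ are independent with mean $0$ and uniformly sub-Gaussian: for some constants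 $K>0,\sigma_0$, $\ \sup_n\max_{i\le n}K^2\bigl(\mathbb E e^{|w_i|^2/K^2}-1\bigr)\le\sigma_0^2$. Let $P(f^*)>0$, and let the (possibly data-dependent) tuning parameters $\lambda_n\ge 0$ satisfy $\lambda_n^{-1}=O_P(n^{2/(2+\alpha)})$, i.e. $n^{-2/(2+\alpha)}=O_P(\lambda_n)$. Let $L(f)=\frac1n\sum_{i=1}^n(y_i-f(x_i))^2+\lambda_nP(f)$ and let $\hat f$ minimize $L$ over $\mathcal F$. For a mesh of $m=m_n$ points, an interpolator $\Omega:\mathbb R^m\to\mathcal F$ and a discretized penalty $P_D:\mathbb R^m\to\mathbb R$, let $\tilde f_D$ minimize $L_D(\theta)=\frac1n\sum_{i=1}^n(y_i-\Omega(\theta)(x_i))^2+\lambda_nP_D(\theta)$ over $\theta\in\mathbb R^m$. If $$L(\Omega(\tilde f_D))\le L(\hat f)+\Gamma_{n,m}\quad\text{almost surely},$$ then, as $n\to\infty$, $$\|\Omega(\tilde f_D)-f^*\|_n^2=O_P(\lambda_n+6\,\Gamma_{n,m}).$$ In particular, if $\Gamma_{n,m}=O_P(\lambda_n)$, then $\|\Omega(\tilde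 f_D)-f^*\|_n^2=O_P(\lambda_n)$; and if moreover $\lambda_n=O_P(n^{-2/(2+\alpha)})$, then $\|\Omega(\tilde f_D)-f^*\|_n^2=O_P(n^{-2/(2+\alpha)})$. -/

import Mathlib

open MeasureTheory ProbabilityTheory Filter

noncomputable section

namespace MBS

/-- `a n = O_P(b n)` as `n → ∞`: for every `ε > 0` there is a constant `M` such that, for all large
`n`, the event `|a n| > M * |b n|` has probability at most `ε`.  For sets that are not measurable
`μ` is the outer measure. -/
def IsBigOP {Ω : Type*} [MeasurableSpace Ω] (μ : Measure Ω) (a b : ℕ → Ω → ℝ) : Prop :=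
  ∀ ε : ℝ, 0 < ε → ∃ M : ℝ, 0 < M ∧
    ∀ᶠ n : ℕ in atTop, μ {ω | M * |b n ω| < |a n ω|} ≤ ENNReal.ofReal ε

section Empirical

variable {X : Type*} {n : ℕ}

/-- `‖g‖_n ^ 2 = (1 / n) * ∑ i, g (x i) ^ 2`, the squared `L₂(Q_n)`-norm, where `Q_n` is the empirical
measure of the design points `x i`. -/
def empNormSq (x : Fin n → X) (g : X → ℝ) : ℝ :=
  (1 / (n : ℝ)) * ∑ i, g (x i) ^ 2

/-- The `L₂(Q_n)`-norm. -/
def empNorm (x : Fin n → X) (g : X → ℝ) : ℝ :=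
  Real.sqrt (empNormSq x g)

/-- `N(δ, G, Q_n)`: the least number of `L₂(Q_n)`-balls of radius `δ` that cover `G`
(the centres need not belong to `G`); it is `⊤` if no finite number suffices. -/
def coveringNumber (δ : ℝ) (G : Set (X → ℝ)) (x : Fin n → X) : ℕ∞ :=
  ⨅ (T : Finset (X → ℝ)) (_ : ∀ g ∈ G, ∃ h ∈ T, empNorm x (g - h) ≤ δ), (T.card : ℕ∞)

/-- `H(δ, G, Q_n) = log N(δ, G, Q_n)`, with value `⊤` if the covering number is infinite. -/
def entropy (δ : ℝ) (G : Set (X → ℝ)) (x : Fin n → X) : EReal :=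
  ENNReal.log (coveringNumber δ G x : ENNReal)

/-- The penalized least squares criterion
`L(f) = (1 / n) * ∑ i, (y i - f (x i)) ^ 2 + lam * P f`. -/
def penLoss (x : Fin n → X) (y : Fin n → ℝ) (lam : ℝ) (P : (X → ℝ) → ℝ) (f : X → ℝ) : ℝ :=
  (1 / (n : ℝ)) * ∑ i, (y i - f (x i)) ^ 2 + lam * P f

/-- The mesh criterion `L_D(θ) = (1 / n) * ∑ i, (y i - Ω_{x i}(θ)) ^ 2 + lam * P_D(θ)` of a vector `θ`
of fitted values at `m` mesh points, with interpolator `interp` and discretized penalty `PD`. -/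
def meshLoss {m : ℕ} (x : Fin n → X) (y : Fin n → ℝ) (lam : ℝ)
    (interp : (Fin m → ℝ) → (X → ℝ)) (PD : (Fin m → ℝ) → ℝ) (θ : Fin m → ℝ) : ℝ :=
  (1 / (n : ℝ)) * ∑ i, (y i - interp θ (x i)) ^ 2 + lam * PD θ

end Empirical

/-- `F` is a cone: it is stable under multiplication by positive scalars. -/
def IsCone {X : Type*} (F : Set (X → ℝ)) : Prop :=
  ∀ f ∈ F, ∀ t : ℝ, 0 < t → t • f ∈ F

/-- `P` is a penalty of degree `v` on `F`: it is nonnegative and `P (t f) = t ^ v * P f` for `t > 0`.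
For instance `∫ |f^(k)| ^ ℓ` has degree `ℓ`, see below; total variations of derivatives and
sup-norms of derivatives have degree `1`. -/
structure IsPenalty {X : Type*} (F : Set (X → ℝ)) (P : (X → ℝ) → ℝ) (v : ℝ) : Prop where
  nonneg : ∀ f ∈ F, 0 ≤ P f
  smul : ∀ f ∈ F, ∀ t : ℝ, 0 < t → P (t • f) = t ^ v * P f

/-- The Sobolev penalty `∫_a^b |f^(r + 1)| ^ ℓ` of a function of one variable. -/
def sobolevPenalty (a b : ℝ) (r : ℕ) (ℓ : ℝ) (f : ℝ → ℝ) : ℝ :=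
  ∫ u in Set.Icc a b, |iteratedDeriv (r + 1) f u| ^ ℓ

/-- The Sobolev penalty is a penalty of degree `ℓ` on every class of functions. -/
theorem sobolevPenalty_isPenalty (F : Set (ℝ → ℝ)) (a b : ℝ) (r : ℕ) (ℓ : ℝ) :
    IsPenalty F (sobolevPenalty a b r ℓ) ℓ where
  nonneg f _ := integral_nonneg fun u => Real.rpow_nonneg (abs_nonneg _) _
  smul f _ t ht := by
    unfold sobolevPenalty
    rw [← integral_const_mul]
    congr 1
    funext u
    have h : iteratedDeriv (r + 1) (t • f) u = t * iteratedDeriv (r + 1) f u :=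
      iteratedDeriv_const_mul_field t f
    rw [h, abs_mul, abs_of_pos ht, Real.mul_rpow ht.le (abs_nonneg _)]

/-- The iterated partial derivative of `f` in the coordinate directions listed in `s`. -/
def iteratedPartial {p : ℕ} (s : List (Fin p)) (f : (Fin p → ℝ) → ℝ) : (Fin p → ℝ) → ℝ :=
  s.foldr (fun i g u => lineDeriv ℝ g u (Pi.single i 1)) f

/-- The Sobolev-like penalty `∑ s, ∫ |D^s f| ^ ℓ` over a box of `ℝ^p`, for a finite collection of
iterated partial derivatives. -/
def sobolevPenaltyMulti {p S : ℕ} (a b : Fin p → ℝ) (s : Fin S → List (Fin p)) (ℓ : ℝ)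
    (f : (Fin p → ℝ) → ℝ) : ℝ :=
  ∑ j, ∫ u in Set.Icc a b, |iteratedPartial (s j) f u| ^ ℓ

theorem iteratedPartial_smul {p : ℕ} (s : List (Fin p)) (f : (Fin p → ℝ) → ℝ) (t : ℝ) :
    iteratedPartial s (t • f) = t • iteratedPartial s f := by
  induction s with
  | nil => rfl
  | cons i s ih =>
    funext u
    have h : lineDeriv ℝ (t • iteratedPartial s f) u (Pi.single i 1)
        = t * lineDeriv ℝ (iteratedPartial s f) u (Pi.single i 1) := by
      unfold lineDeriv
      exact deriv_const_mul_field t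
    have e : iteratedPartial (i :: s) (t • f) u
        = lineDeriv ℝ (iteratedPartial s (t • f)) u (Pi.single i 1) := rfl
    rw [e, ih, h]
    rfl

/-- The multivariate Sobolev-like penalty is a penalty of degree `ℓ` on every class of functions. -/
theorem sobolevPenaltyMulti_isPenalty {p S : ℕ} (F : Set ((Fin p → ℝ) → ℝ)) (a b : Fin p → ℝ)
    (s : Fin S → List (Fin p)) (ℓ : ℝ) : IsPenalty F (sobolevPenaltyMulti a b s ℓ) ℓ where
  nonneg f _ := Finset.sum_nonneg fun j _ =>
    integral_nonneg fun u => Real.rpow_nonneg (abs_nonneg _) _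
  smul f _ t ht := by
    unfold sobolevPenaltyMulti
    rw [Finset.mul_sum]
    refine Finset.sum_congr rfl fun j _ => ?_
    rw [← integral_const_mul]
    congr 1
    funext u
    rw [iteratedPartial_smul, Pi.smul_apply, smul_eq_mul, abs_mul, abs_of_pos ht,
      Real.mul_rpow ht.le (abs_nonneg _)]

/-- Errors `w n i`, `i < n`, which for every `n` are independent and centred, and whose tails are
uniformly sub-Gaussian: `K ^ 2 * (E exp (|w n i| ^ 2 / K ^ 2) - 1) ≤ σ₀ ^ 2` for all `n` and `i`.
An i.i.d. sequence is the case where `w n i` does not depend on `n`. -/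
structure IsSubGaussianErrors {Ω : Type*} [MeasurableSpace Ω] (μ : Measure Ω)
    (w : (n : ℕ) → Fin n → Ω → ℝ) (K σ₀ : ℝ) : Prop where
  measurable : ∀ n i, Measurable (w n i)
  indep : ∀ n, iIndepFun (w n) μ
  mean_zero : ∀ n i, ∫ ω, w n i ω ∂μ = 0
  integrable_exp : ∀ n i, Integrable (fun ω => Real.exp (|w n i ω| ^ 2 / K ^ 2)) μ
  subGaussian : ∀ n i, K ^ 2 * (∫ ω, Real.exp (|w n i ω| ^ 2 / K ^ 2) ∂μ - 1) ≤ σ₀ ^ 2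

end MBS

end

/-! Since `fhat` does at least as well as `fstar`, the mesh solution `f` satisfies, with `d = ‖f -
f*‖_n`, the inequality `d² + λ P f ≤ 2⟨w, f - f*⟩_n + λ P f* + Γ` (`MBS.basic_inequality`).
Everything rests on bounding the noise term.

With probability at least `1 - ε`, simultaneously for all `f ∈ F`, it is at most `A n^(-1/2) d^(1 -
α/2) J^(α/2)`, where `J = (P f)^(1/v) + (P f*)^(1/v)` (`MBS.exists_const_empirical_process_le`).
Dividing by `J` moves `f` and `f*` into `{P ≤ 1}`, where the entropy bound allows chaining of a
sub-Gaussian linear process (`exists_const_measure_modulus_le`). The bound is uniform in `f` and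
free of `λ`, so data-dependent `λ` and `f` do no harm.

Young's inequality splits this bound into a fraction of `d²` and a multiple of `n^(-2/(2+α))
J^(2α/(2+α))`. Since `v > 2α/(2+α)`, the latter grows sublinearly in `P f`; as `n^(-2/(2+α)) ≤ M λ`
with high probability, `λ P f` absorbs it up to a constant times `λ`
(`exists_const_sq_le_of_basic_inequality`). -/

/-! ### Sub-Gaussian tails from exponential square moments. -/

/-- What matters is that the linear term has coefficient one and no constant is lost: it disappears
under the expectation of a centred variable. -/
theorem Real.exp_le_add_exp_sq (x : ℝ) : Real.exp x ≤ x + Real.exp (x ^ 2) := by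
  have h2 := Real.add_one_le_exp (x ^ 2)
  rcases le_or_gt |x| 1 with h | h
  · have h1 := (abs_le.1 (Real.abs_exp_sub_one_sub_id_le h)).2
    linarith
  · rcases lt_abs.1 h with h | h
    · have : Real.exp x ≤ Real.exp (x ^ 2) := Real.exp_le_exp.2 (by nlinarith)
      linarith
    · have : Real.exp x ≤ 1 := Real.exp_le_one_iff.2 (by linarith)
      nlinarith

theorem Real.exp_mul_le_of_mem_Icc {s u : ℝ} (hs0 : 0 ≤ s) (hs1 : s ≤ 1) :
    Real.exp (s * u) ≤ 1 + s * (Real.exp u - 1) := by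
  have h := convexOn_exp.2 (Set.mem_univ 0) (Set.mem_univ u) (sub_nonneg.2 hs1) hs0 (by ring)
  simp only [smul_eq_mul, mul_zero, zero_add, Real.exp_zero, mul_one] at h
  linarith

/-- A centred random variable with a finite exponential square moment has a sub-Gaussian moment
generating function. -/
theorem ProbabilityTheory.hasSubgaussianMGF_of_integral_exp_sq
    {Ω : Type*} [MeasurableSpace Ω] {μ : Measure Ω} [IsProbabilityMeasure μ] {W : Ω → ℝ}
    (hW : Measurable W) {K σ : ℝ} (hK : 0 < K) (h0 : ∫ ω, W ω ∂μ = 0)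
    (hint : Integrable (fun ω => Real.exp (|W ω| ^ 2 / K ^ 2)) μ)
    (hle : K ^ 2 * (∫ ω, Real.exp (|W ω| ^ 2 / K ^ 2) ∂μ - 1) ≤ σ ^ 2) :
    HasSubgaussianMGF W (Real.toNNReal (K ^ 2 / 2 + 2 * σ ^ 2)) μ := by
  simp only [sq_abs] at hint hle
  have hK2 : 0 < K ^ 2 := by positivity
  have hexp : ∀ t ω, t * W ω ≤ W ω ^ 2 / K ^ 2 + t ^ 2 * K ^ 2 / 4 := by
    intro t ω
    have : W ω ^ 2 / K ^ 2 + t ^ 2 * K ^ 2 / 4 - t * W ω = (W ω / K - t * K / 2) ^ 2 := by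
      field_simp; ring
    nlinarith [sq_nonneg (W ω / K - t * K / 2)]
  have hintE : ∀ t, Integrable (fun ω => Real.exp (t * W ω)) μ := by
    intro t
    refine (hint.mul_const (Real.exp (t ^ 2 * K ^ 2 / 4))).mono' (by fun_prop)
      (ae_of_all _ fun ω => ?_)
    rw [Real.norm_eq_abs, Real.abs_exp, ← Real.exp_add]
    exact Real.exp_le_exp.2 (hexp t ω)
  have hIle : ∫ ω, Real.exp (W ω ^ 2 / K ^ 2) ∂μ ≤ 1 + σ ^ 2 / K ^ 2 := by
    have : ∫ ω, Real.exp (W ω ^ 2 / K ^ 2) ∂μ - 1 ≤ σ ^ 2 / K ^ 2 := by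
      rw [le_div_iff₀ hK2]; linarith
    linarith
  refine ⟨hintE, fun t => ?_⟩
  rw [Real.coe_toNNReal _ (by positivity)]
  have key : (K ^ 2 / 2 + 2 * σ ^ 2) * t ^ 2 / 2 = t ^ 2 * K ^ 2 / 4 + t ^ 2 * σ ^ 2 := by ring
  rw [key, mgf]
  -- For small `t` the mean zero kills the linear term and convexity pulls the factor `t² K² ≤ 1`
  -- out of the exponent, giving `exp (t² σ²)`. For large `t`, completing the square costs `exp (t²
  -- K² / 4)` and `σ² / K² ≤ t² σ²`. The variance proxy adds both exponents.
  rcases le_or_gt (t ^ 2 * K ^ 2) 1 with h | h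
  · have hWint : Integrable W μ := by
      refine (hint.const_mul K).mono' hW.aestronglyMeasurable (ae_of_all _ fun ω => ?_)
      rw [Real.norm_eq_abs]
      have h1 := Real.add_one_le_exp (W ω ^ 2 / K ^ 2)
      have h2 : |W ω| ≤ K * (W ω ^ 2 / K ^ 2 + 1) := by
        have : K * (W ω ^ 2 / K ^ 2 + 1) - |W ω| = (|W ω| ^ 2 - |W ω| * K + K ^ 2) / K := by
          rw [sq_abs]; field_simp; ring
        have h3 : 0 ≤ (|W ω| ^ 2 - |W ω| * K + K ^ 2) / K := by
          apply div_nonneg _ hK.le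
          nlinarith [sq_nonneg (|W ω| - K / 2)]
        linarith
      exact h2.trans (by gcongr)
    have hbd : ∀ ω, Real.exp (t * W ω) ≤
        t * W ω + (1 + t ^ 2 * K ^ 2 * (Real.exp (W ω ^ 2 / K ^ 2) - 1)) := by
      intro ω
      have h1 := Real.exp_le_add_exp_sq (t * W ω)
      have h2 := Real.exp_mul_le_of_mem_Icc (u := W ω ^ 2 / K ^ 2) (by positivity) h
      have h3 : t ^ 2 * K ^ 2 * (W ω ^ 2 / K ^ 2) = (t * W ω) ^ 2 := by field_simp
      rw [h3] at h2
      linarith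
    have hint1 : Integrable (fun ω => Real.exp (W ω ^ 2 / K ^ 2) - 1) μ :=
      hint.sub (integrable_const _)
    have hint2 : Integrable
        (fun ω => 1 + t ^ 2 * K ^ 2 * (Real.exp (W ω ^ 2 / K ^ 2) - 1)) μ :=
      (integrable_const _).add (hint1.const_mul _)
    calc ∫ ω, Real.exp (t * W ω) ∂μ
        ≤ ∫ ω, (t * W ω + (1 + t ^ 2 * K ^ 2 * (Real.exp (W ω ^ 2 / K ^ 2) - 1))) ∂μ :=
          integral_mono (hintE t) ((hWint.const_mul t).add hint2) hbd
      _ = 1 + t ^ 2 * (K ^ 2 * (∫ ω, Real.exp (W ω ^ 2 / K ^ 2) ∂μ - 1)) := by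
          rw [integral_add (hWint.const_mul t) hint2,
            integral_add (integrable_const _) (hint1.const_mul _),
            integral_const_mul, integral_const_mul, integral_sub hint (integrable_const _), h0]
          simp
          ring
      _ ≤ 1 + t ^ 2 * σ ^ 2 := by gcongr
      _ ≤ Real.exp (t ^ 2 * σ ^ 2) := by linarith [Real.add_one_le_exp (t ^ 2 * σ ^ 2)]
      _ ≤ _ := Real.exp_le_exp.2 (by nlinarith [sq_nonneg t])
  · calc ∫ ω, Real.exp (t * W ω) ∂μ
        ≤ ∫ ω, Real.exp (W ω ^ 2 / K ^ 2) * Real.exp (t ^ 2 * K ^ 2 / 4) ∂μ := by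
          refine integral_mono (hintE t) (hint.mul_const _) fun ω => ?_
          simp only [← Real.exp_add]
          exact Real.exp_le_exp.2 (hexp t ω)
      _ ≤ (1 + σ ^ 2 / K ^ 2) * Real.exp (t ^ 2 * K ^ 2 / 4) := by
          rw [integral_mul_const]; gcongr
      _ ≤ Real.exp (t ^ 2 * σ ^ 2) * Real.exp (t ^ 2 * K ^ 2 / 4) := by
          gcongr
          have h1 : σ ^ 2 / K ^ 2 ≤ t ^ 2 * σ ^ 2 := by
            rw [div_le_iff₀ hK2]; nlinarith [sq_nonneg σ]
          linarith [Real.add_one_le_exp (t ^ 2 * σ ^ 2)]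
      _ = _ := by rw [← Real.exp_add]; ring_nf

/-- Two-sided tail bound for linear combinations of independent sub-Gaussian variables. -/
theorem ProbabilityTheory.measure_inner_tail_le_of_iIndepFun
    {Ω : Type*} [MeasurableSpace Ω] {μ : Measure Ω} [IsProbabilityMeasure μ] {n : ℕ}
    {w : Fin n → Ω → ℝ} (hind : iIndepFun w μ) {s : ℝ} (hs : 0 < s)
    (hw : ∀ i, HasSubgaussianMGF (w i) (Real.toNNReal s) μ)
    (a : EuclideanSpace ℝ (Fin n)) {t : ℝ} (ht : 0 < t) :
    μ {ω | t * ‖a‖ < |∑ i, a i * w i ω|} ≤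
      ENNReal.ofReal (2 * Real.exp (-t ^ 2 / (2 * s))) := by
  rcases eq_or_ne a 0 with rfl | ha
  · simp
  have hna : 0 < ‖a‖ := norm_pos_iff.2 ha
  have hind' : iIndepFun (fun i ω => a i * w i ω) μ :=
    hind.comp (fun i z => a i * z) (fun i => measurable_const_mul _)
  obtain ⟨cc, hcc⟩ : ∃ cc, cc = ∑ i, Real.toNNReal (a i ^ 2) * Real.toNNReal s := ⟨_, rfl⟩
  have hsum : HasSubgaussianMGF (fun ω => ∑ i, a i * w i ω) cc μ := by
    rw [hcc]
    refine HasSubgaussianMGF.sum_of_iIndepFun hind' fun i _ => ?_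
    rw [Real.toNNReal_of_nonneg (sq_nonneg (a i))]
    exact (hw i).const_mul (a i)
  have hc : (cc : ℝ) = s * ‖a‖ ^ 2 := by
    rw [hcc, EuclideanSpace.real_norm_sq_eq, Finset.mul_sum]
    push_cast
    refine Finset.sum_congr rfl fun i _ => ?_
    rw [Real.coe_toNNReal _ hs.le, Real.coe_toNNReal _ (sq_nonneg _), mul_comm]
  have hexp : -(t * ‖a‖) ^ 2 / (2 * (cc : ℝ)) = -t ^ 2 / (2 * s) := by
    rw [hc]; field_simp
  have h1 := hsum.measure_ge_le (ε := t * ‖a‖) (by positivity)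
  have h2 := hsum.neg.measure_ge_le (ε := t * ‖a‖) (by positivity)
  rw [hexp] at h1 h2
  rw [← ofReal_measureReal]
  refine ENNReal.ofReal_le_ofReal ?_
  refine (measureReal_mono (s₂ := {ω | t * ‖a‖ ≤ ∑ i, a i * w i ω} ∪
    {ω | t * ‖a‖ ≤ (-fun ω => ∑ i, a i * w i ω) ω}) ?_).trans
    ((measureReal_union_le _ _).trans (by linarith))
  intro ω hω
  rcases lt_abs.1 (show t * ‖a‖ < |_| from hω) with h | h
  · exact Or.inl h.le
  · exact Or.inr h.le

/-! ### Chaining. -/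

/-- Chaining along dyadic nets, for a fixed linear functional whose increments are controlled. -/
theorem abs_le_norm_rpow_of_chaining {V : Type*} [NormedAddCommGroup V] [NormedSpace ℝ V]
    (Z : V →L[ℝ] ℝ) {α A R : ℝ} (hα2 : α < 2) (hA : 0 ≤ A) (hR : 0 < R)
    {T : ℕ → Finset V} (h0 : ∀ k, 0 ∈ T k) {G : Set V}
    (hT : ∀ k, ∀ g ∈ G, ∃ h ∈ T k, ‖g - h‖ ≤ R * (1 / 2) ^ k) (hG : ∀ g ∈ G, ‖g‖ ≤ R)
    (hgood : ∀ k, ∀ h ∈ T k, ∀ h' ∈ T (k + 1),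
      |Z (h' - h)| ≤ A * (R * (1 / 2) ^ k) ^ (-(α / 2)) * ‖h' - h‖) {g : V} (hg : g ∈ G) :
    |Z g| ≤ A * (2 * 2 ^ (1 - α / 2) * (1 - (1 / 2 : ℝ) ^ (1 - α / 2))⁻¹) *
      ‖g‖ ^ (1 - α / 2) := by
  set β := 1 - α / 2 with hβ
  have hβ0 : 0 < β := by rw [hβ]; linarith
  set ρ : ℝ := (1 / 2 : ℝ) ^ β with hρ
  have hρ0 : 0 < ρ := by positivity
  have hρ1 : ρ < 1 := Real.rpow_lt_one (by norm_num) (by norm_num) hβ0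
  rcases eq_or_ne g 0 with rfl | hg0
  · simp [Real.zero_rpow hβ0.ne']
  have hng : 0 < ‖g‖ := norm_pos_iff.2 hg0
  -- The scale of `g`: `R 2^(-j-1) < ‖g‖ ≤ R 2^(-j)`. At level `j` the point `0` already
  -- approximates `g`, so the chain starts there; this yields a power of `‖g‖` instead of a power of
  -- `R`.
  obtain ⟨j, hj1, hj2⟩ := exists_nat_pow_near_of_lt_one (div_pos hng hR)
    ((div_le_one hR).2 (hG g hg)) (by norm_num : (0 : ℝ) < 1 / 2) (by norm_num)
  rw [lt_div_iff₀ hR] at hj1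
  rw [div_le_iff₀ hR] at hj2
  choose π hπT hπ using fun k => hT k g hg
  set p : ℕ → V := fun k => if k = 0 then 0 else π (j + k) with hp
  have hpT : ∀ k, p k ∈ T (j + k) := by
    intro k
    simp only [hp]
    split_ifs
    · exact h0 _
    · exact hπT _
  have hpd : ∀ k, ‖g - p k‖ ≤ R * (1 / 2) ^ (j + k) := by
    intro k
    simp only [hp]
    split_ifs with hk
    · subst hk; simpa [mul_comm] using hj2
    · exact hπ _
  set D := (R * (1 / 2) ^ j) ^ β with hD
  have hD0 : 0 ≤ D := by positivity
  -- At radius `δ` a link has length at most `2δ` and weight `A δ^(-α/2)`, hence contributes at most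
  -- `2 A δ^(1 - α/2)`: a geometric sequence because `α < 2`.
  have hstep : ∀ k, |Z (p (k + 1) - p k)| ≤ 2 * A * D * ρ ^ k := by
    intro k
    have hδ : 0 < R * (1 / 2 : ℝ) ^ (j + k) := by positivity
    have hn : ‖p (k + 1) - p k‖ ≤ 2 * (R * (1 / 2) ^ (j + k)) := by
      have e : p (k + 1) - p k = (g - p k) - (g - p (k + 1)) := by abel
      rw [e]
      refine (norm_sub_le _ _).trans ?_
      have h1 := hpd k
      have h2 := hpd (k + 1)
      have h3 : R * (1 / 2 : ℝ) ^ (j + (k + 1)) = R * (1 / 2) ^ (j + k) * (1 / 2) := by ring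
      rw [h3] at h2
      linarith
    refine (hgood (j + k) (p k) (hpT k) (p (k + 1)) (hpT (k + 1))).trans ?_
    have e1 : (R * (1 / 2 : ℝ) ^ (j + k)) ^ (-(α / 2)) * (R * (1 / 2 : ℝ) ^ (j + k)) =
        D * ρ ^ k := by
      rw [← Real.rpow_add_one hδ.ne', show -(α / 2) + 1 = β by rw [hβ]; ring, pow_add,
        ← mul_assoc, Real.mul_rpow (by positivity) (by positivity), hρ, ← Real.rpow_natCast,
        ← Real.rpow_natCast, ← Real.rpow_natCast, ← Real.rpow_mul (by norm_num),
        ← Real.rpow_mul (by norm_num), mul_comm (k : ℝ) β, hD, ← Real.rpow_natCast]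
    calc A * (R * (1 / 2) ^ (j + k)) ^ (-(α / 2)) * ‖p (k + 1) - p k‖
        ≤ A * (R * (1 / 2) ^ (j + k)) ^ (-(α / 2)) * (2 * (R * (1 / 2) ^ (j + k))) := by
          gcongr
      _ = 2 * A * ((R * (1 / 2 : ℝ) ^ (j + k)) ^ (-(α / 2)) * (R * (1 / 2 : ℝ) ^ (j + k))) := by
          ring
      _ = _ := by rw [e1]; ring
  have hsum : ∀ k, |Z (p k)| ≤ 2 * A * D * ∑ i ∈ Finset.range k, ρ ^ i := by
    intro k
    induction k with
    | zero => simp [hp]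
    | succ k ih =>
      have e : Z (p (k + 1)) = Z (p (k + 1) - p k) + Z (p k) := by rw [map_sub]; ring
      rw [e, Finset.sum_range_succ, mul_add]
      refine (abs_add_le _ _).trans ?_
      linarith [hstep k]
  have hbound : ∀ k, |Z (p k)| ≤ 2 * A * D * (1 - ρ)⁻¹ := fun k =>
    (hsum k).trans (mul_le_mul_of_nonneg_left
      (by
        rw [← tsum_geometric_of_lt_one hρ0.le hρ1]
        exact (summable_geometric_of_lt_one hρ0.le hρ1).sum_le_tsum _
          (fun i _ => by positivity)) (by positivity))
  have hlim : Tendsto p atTop (nhds g) := by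
    rw [tendsto_iff_norm_sub_tendsto_zero]
    have : Tendsto (fun k : ℕ => R * (1 / 2 : ℝ) ^ j * (1 / 2 : ℝ) ^ k) atTop (nhds 0) := by
      simpa using (tendsto_pow_atTop_nhds_zero_of_lt_one (by norm_num : (0 : ℝ) ≤ 1 / 2)
        (by norm_num)).const_mul (R * (1 / 2 : ℝ) ^ j)
    refine squeeze_zero (fun _ => norm_nonneg _) (fun k => ?_) this
    rw [norm_sub_rev]
    refine (hpd k).trans_eq ?_
    ring
  have hZg : |Z g| ≤ 2 * A * D * (1 - ρ)⁻¹ :=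
    le_of_tendsto ((continuous_abs.comp Z.continuous).tendsto g |>.comp hlim)
      (Eventually.of_forall hbound)
  have hDle : D ≤ 2 ^ β * ‖g‖ ^ β := by
    rw [← Real.mul_rpow (by norm_num) hng.le]
    refine Real.rpow_le_rpow (by positivity) ?_ hβ0.le
    have : (1 / 2 : ℝ) ^ (j + 1) * R = R * (1 / 2) ^ j / 2 := by ring
    rw [this] at hj1
    linarith
  have h1ρ : 0 < (1 - ρ)⁻¹ := inv_pos.2 (by linarith)
  calc |Z g| ≤ 2 * A * D * (1 - ρ)⁻¹ := hZg
    _ ≤ 2 * A * (2 ^ β * ‖g‖ ^ β) * (1 - ρ)⁻¹ := by gcongr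
    _ = _ := by ring

/-- Modulus of continuity at the origin of a sub-Gaussian linear process indexed by a bounded set of
polynomial metric entropy; the constant depends on the entropy bound only. -/
theorem exists_const_measure_modulus_le {Ω : Type*} [MeasurableSpace Ω] (μ : Measure Ω)
    {α C R s ε : ℝ} (hα0 : 0 < α) (hα2 : α < 2) (hC : 0 < C) (hR : 0 < R) (hs : 0 < s)
    (hε : 0 < ε) :
    ∃ A : ℝ, 0 < A ∧ ∀ (V : Type*) [NormedAddCommGroup V] [NormedSpace ℝ V]
      (Z : Ω → V →L[ℝ] ℝ) (G : Set V), (∀ g ∈ G, ‖g‖ ≤ R) →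
      (∀ δ : ℝ, 0 < δ → ∃ T : Finset V, (T.card : ℝ) ≤ Real.exp (C * δ ^ (-α)) ∧
        ∀ g ∈ G, ∃ h ∈ T, ‖g - h‖ ≤ δ) →
      (∀ (a : V) (t : ℝ), 0 < t → μ {ω | t * ‖a‖ < |Z ω a|} ≤
        ENNReal.ofReal (2 * Real.exp (-t ^ 2 / (2 * s)))) →
      μ {ω | ∃ g ∈ G, A * ‖g‖ ^ (1 - α / 2) < |Z ω g|} ≤ ENNReal.ofReal ε := by
  set q : ℝ := 2 ^ α with hq
  have hq1 : 1 < q := Real.one_lt_rpow (by norm_num) hα0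
  have hq0 : 0 < q := by linarith
  set b : ℝ := R ^ (-α) with hb
  have hb0 : 0 < b := by positivity
  have hqi : 0 < 1 - q⁻¹ := by
    have := inv_lt_one_of_one_lt₀ hq1
    linarith
  -- `C (1 + q)` in `A₀` pays for the entropies of two consecutive nets. The surplus `D` leaves `8
  -- exp (-D b q^k)` at level `k`, where `8` collects a factor two from each net (for the added `0`)
  -- and two from the two-sided tail. `D` makes the resulting geometric majorant sum to `ε`.
  set D : ℝ := 8 / (ε * b * (1 - q⁻¹)) with hD
  have hD0 : 0 < D := by positivity
  set A₀ : ℝ := Real.sqrt (2 * s * (D + C * (1 + q))) with hA₀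
  have hA0 : 0 < A₀ := by positivity
  have hA2 : A₀ ^ 2 = 2 * s * (D + C * (1 + q)) := Real.sq_sqrt (by positivity)
  have hβ : (1 / 2 : ℝ) ^ (1 - α / 2) < 1 :=
    Real.rpow_lt_one (by norm_num) (by norm_num) (by linarith)
  refine ⟨A₀ * (2 * 2 ^ (1 - α / 2) * (1 - (1 / 2 : ℝ) ^ (1 - α / 2))⁻¹),
    mul_pos hA0 (mul_pos (by positivity) (inv_pos.2 (by linarith))), ?_⟩
  intro V _ _ Z G hG hnet htail
  classical
  have hδ : ∀ k : ℕ, 0 < R * (1 / 2 : ℝ) ^ k := fun k => by positivity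
  have hδα : ∀ k : ℕ, (R * (1 / 2 : ℝ) ^ k) ^ (-α) = b * q ^ k := by
    intro k
    rw [Real.mul_rpow hR.le (by positivity), one_div, inv_pow, Real.inv_rpow (by positivity),
      Real.rpow_neg (show (0 : ℝ) ≤ 2 ^ k by positivity), inv_inv, hq, ← Real.rpow_natCast,
      ← Real.rpow_natCast,
      ← Real.rpow_mul (by norm_num), ← Real.rpow_mul (by norm_num), mul_comm (k : ℝ)]
  choose T₀ hT₀c hT₀ using fun k : ℕ => hnet _ (hδ k)
  set T : ℕ → Finset V := fun k => insert 0 (T₀ k) with hT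
  have hTc : ∀ k, ((T k).card : ℝ) ≤ 2 * Real.exp (C * (b * q ^ k)) := by
    intro k
    have h1 : ((T k).card : ℝ) ≤ (T₀ k).card + 1 := by
      exact_mod_cast Finset.card_insert_le _ _
    have h2 := hT₀c k
    rw [hδα] at h2
    have h3 : 1 ≤ Real.exp (C * (b * q ^ k)) := Real.one_le_exp (by positivity)
    linarith
  set t : ℕ → ℝ := fun k => A₀ * (R * (1 / 2) ^ k) ^ (-(α / 2)) with ht
  have ht0 : ∀ k, 0 < t k := fun k => mul_pos hA0 (Real.rpow_pos_of_pos (hδ k) _)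
  have ht2 : ∀ k, t k ^ 2 = A₀ ^ 2 * (b * q ^ k) := by
    intro k
    rw [ht, mul_pow, ← Real.rpow_mul_natCast (hδ k).le, ← hδα]
    congr 2
    push_cast
    ring
  have hsub : {ω | ∃ g ∈ G, A₀ * (2 * 2 ^ (1 - α / 2) * (1 - (1 / 2 : ℝ) ^ (1 - α / 2))⁻¹) *
        ‖g‖ ^ (1 - α / 2) < |Z ω g|} ⊆
      ⋃ k, ⋃ h ∈ T k, ⋃ h' ∈ T (k + 1), {ω | t k * ‖h' - h‖ < |Z ω (h' - h)|} := by
    rintro ω ⟨g, hg, hlt⟩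
    by_contra hω
    simp only [Set.mem_iUnion, Set.mem_ofPred_eq, not_exists, not_lt] at hω
    refine hlt.not_ge (abs_le_norm_rpow_of_chaining (Z ω) hα2 hA0.le hR (T := T)
      (fun k => Finset.mem_insert_self _ _) (fun k g hg => ?_) hG
      (fun k h hh h' hh' => hω k h hh h' hh') hg)
    obtain ⟨h, hh, hle⟩ := hT₀ k g hg
    exact ⟨h, Finset.mem_insert_of_mem hh, hle⟩
  have hlevel : ∀ k, μ (⋃ h ∈ T k, ⋃ h' ∈ T (k + 1), {ω | t k * ‖h' - h‖ < |Z ω (h' - h)|}) ≤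
      ENNReal.ofReal (8 / (D * b) * q⁻¹ ^ k) := by
    intro k
    have hu : μ (⋃ h ∈ T k, ⋃ h' ∈ T (k + 1), {ω | t k * ‖h' - h‖ < |Z ω (h' - h)|}) ≤
        ∑ h ∈ T k, ∑ h' ∈ T (k + 1), ENNReal.ofReal (2 * Real.exp (-t k ^ 2 / (2 * s))) :=
      (measure_biUnion_finset_le _ _).trans (Finset.sum_le_sum fun h _ =>
        (measure_biUnion_finset_le _ _).trans (Finset.sum_le_sum fun h' _ =>
          htail _ _ (ht0 k)))
    refine hu.trans ?_
    simp only [Finset.sum_const, nsmul_eq_mul]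
    rw [← ENNReal.ofReal_natCast, ← ENNReal.ofReal_natCast, ← ENNReal.ofReal_mul (by positivity),
      ← ENNReal.ofReal_mul (by positivity)]
    refine ENNReal.ofReal_le_ofReal ?_
    have hbq : 0 < b * q ^ k := by positivity
    have e1 : -t k ^ 2 / (2 * s) = -(D + C * (1 + q)) * (b * q ^ k) := by
      rw [ht2, hA2]; field_simp
    calc ((T k).card : ℝ) * ((T (k + 1)).card * (2 * Real.exp (-t k ^ 2 / (2 * s))))
        ≤ (2 * Real.exp (C * (b * q ^ k))) * ((2 * Real.exp (C * (b * q ^ (k + 1)))) *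
            (2 * Real.exp (-t k ^ 2 / (2 * s)))) := by
          gcongr
          · exact hTc k
          · exact hTc (k + 1)
      _ = 8 * Real.exp (-(D * (b * q ^ k))) := by
          rw [e1, show -(D * (b * q ^ k)) = C * (b * q ^ k) + (C * (b * q ^ (k + 1)) +
            -(D + C * (1 + q)) * (b * q ^ k)) by ring, Real.exp_add, Real.exp_add]
          ring
      _ ≤ 8 * (D * (b * q ^ k))⁻¹ := by
          rw [Real.exp_neg]
          gcongr
          linarith [Real.add_one_le_exp (D * (b * q ^ k))]
      _ = 8 / (D * b) * q⁻¹ ^ k := by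
          rw [inv_pow]; field_simp
  have hsumm : Summable fun k : ℕ => 8 / (D * b) * q⁻¹ ^ k :=
    (summable_geometric_of_lt_one (by positivity) (by linarith)).mul_left _
  calc μ _ ≤ μ (⋃ k, ⋃ h ∈ T k, ⋃ h' ∈ T (k + 1),
        {ω | t k * ‖h' - h‖ < |Z ω (h' - h)|}) := measure_mono hsub
    _ ≤ ∑' k, ENNReal.ofReal (8 / (D * b) * q⁻¹ ^ k) :=
        (measure_iUnion_le _).trans (ENNReal.tsum_le_tsum hlevel)
    _ = ENNReal.ofReal (∑' k : ℕ, 8 / (D * b) * q⁻¹ ^ k) :=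
        (ENNReal.ofReal_tsum_of_nonneg (fun k => by positivity) hsumm).symm
    _ = ENNReal.ofReal ε := by
        rw [tsum_mul_left, tsum_geometric_of_lt_one (by positivity) (by linarith), hD]
        congr 1
        have hq1' : q - 1 ≠ 0 := by linarith
        field_simp

/-! ### Solving the basic inequality deterministically. -/

theorem Real.rpow_add_le_add_rpow_of_le_one {x y p : ℝ} (hx : 0 ≤ x) (hy : 0 ≤ y) (hp0 : 0 ≤ p)
    (hp1 : p ≤ 1) : (x + y) ^ p ≤ x ^ p + y ^ p := by
  lift x to NNReal using hx
  lift y to NNReal using hy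
  exact_mod_cast NNReal.rpow_add_le_add_rpow x y hp0 hp1

/-- The curves `E p^s` and `p` cross at `p = E^(1/(1-s))`. Past the crossing the linear term wins;
before it the power is at most its value there, which serves as `C`. -/
theorem Real.exists_mul_rpow_le_add {s E : ℝ} (hs0 : 0 ≤ s) (hs1 : s < 1) (hE : 0 ≤ E) :
    ∃ C : ℝ, 0 ≤ C ∧ ∀ p : ℝ, 0 ≤ p → E * p ^ s ≤ p + C := by
  have h1s : 0 < 1 - s := by linarith
  set C₀ := E ^ (1 / (1 - s)) with hC₀
  have hC0 : 0 ≤ C₀ := by positivity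
  refine ⟨E * C₀ ^ s, by positivity, fun p hp => ?_⟩
  rcases le_or_gt p C₀ with h | h
  · have : E * p ^ s ≤ E * C₀ ^ s := by gcongr
    linarith
  · have hp0 : 0 < p := by linarith
    have hE' : E ≤ p ^ (1 - s) := by
      have : E = C₀ ^ (1 - s) := by
        rw [hC₀, ← Real.rpow_mul hE, one_div_mul_cancel h1s.ne', Real.rpow_one]
      rw [this]
      gcongr
    have : E * p ^ s ≤ p := by
      calc E * p ^ s ≤ p ^ (1 - s) * p ^ s := by gcongr
        _ = p := by rw [← Real.rpow_add hp0, sub_add_cancel, Real.rpow_one]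
    have : 0 ≤ E * C₀ ^ s := by positivity
    linarith

/-- Solving the basic inequality of penalized least squares. -/
theorem exists_const_sq_le_of_basic_inequality {α v A M ps : ℝ} (hα0 : 0 < α) (hα2 : α < 2)
    (hv : 2 * α / (2 + α) < v) (hA : 0 ≤ A) (hM : 0 ≤ M) (hps : 0 ≤ ps) :
    ∃ B : ℝ, 0 < B ∧ ∀ d p l η Γ : ℝ, 0 ≤ d → 0 ≤ p → 0 ≤ l → 0 ≤ η → 0 ≤ Γ → η ≤ M * l →
      d ^ 2 + l * p ≤ 2 * (A * η ^ ((2 + α) / 4) * d ^ (1 - α / 2) *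
        (p ^ (1 / v) + ps ^ (1 / v)) ^ (α / 2)) + l * ps + Γ →
      d ^ 2 ≤ B * (l + Γ) := by
  set u := 2 * α / (2 + α) with hu
  have hu0 : 0 < u := by positivity
  have hu1 : u < 1 := by rw [hu, div_lt_one (by linarith)]; linarith
  have hv0 : 0 < v := hu0.trans hv
  have hs1 : u / v < 1 := (div_lt_one hv0).2 hv
  set E := (1 + α / 2) * A ^ (4 / (2 + α)) * M with hE
  have hE0 : 0 ≤ E := by positivity
  obtain ⟨C, hC0, hC⟩ := Real.exists_mul_rpow_le_add (s := u / v) (by positivity) hs1 hE0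
  refine ⟨(C + E * ps ^ (u / v) + ps + 1) / (α / 2), by positivity, ?_⟩
  intro d p l η Γ hd hp hl hη hΓ hηl hb
  set J := p ^ (1 / v) + ps ^ (1 / v) with hJ
  have hJ0 : 0 ≤ J := by positivity
  -- The weights are forced by the exponent `1 - α/2` of `d`. After doubling, the `d²` term has
  -- coefficient `1 - α/2`, so `α/2` of `d²` survives on the left, whence the denominator of the
  -- constant.
  have hyoung : A * η ^ ((2 + α) / 4) * d ^ (1 - α / 2) * J ^ (α / 2) ≤
      (1 - α / 2) / 2 * d ^ 2 + (1 + α / 2) / 2 * (A ^ (4 / (2 + α)) * η * J ^ u) := by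
    have h := Real.geom_mean_le_arith_mean2_weighted (w₁ := (1 - α / 2) / 2)
      (w₂ := (1 + α / 2) / 2) (p₁ := d ^ 2) (p₂ := A ^ (4 / (2 + α)) * η * J ^ u)
      (by linarith) (by linarith) (by positivity) (by positivity) (by ring)
    refine le_trans (le_of_eq ?_) h
    rw [Real.mul_rpow (by positivity) (by positivity), Real.mul_rpow (by positivity) hη,
      ← Real.rpow_mul hA, ← Real.rpow_mul hJ0, ← Real.rpow_natCast d, ← Real.rpow_mul hd]
    have e1 : 4 / (2 + α) * ((1 + α / 2) / 2) = 1 := by field_simp; ring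
    have e2 : u * ((1 + α / 2) / 2) = α / 2 := by rw [hu]; field_simp
    have e3 : ((2 : ℕ) : ℝ) * ((1 - α / 2) / 2) = 1 - α / 2 := by push_cast; ring
    have e4 : (1 + α / 2) / 2 = (2 + α) / 4 := by ring
    rw [e1, e2, e3, e4, Real.rpow_one]
    ring
  have hJu : J ^ u ≤ p ^ (u / v) + ps ^ (u / v) := by
    refine (Real.rpow_add_le_add_rpow_of_le_one (by positivity) (by positivity) hu0.le
      hu1.le).trans ?_
    rw [← Real.rpow_mul hp, ← Real.rpow_mul hps, one_div_mul_eq_div]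
  have hmain : (1 + α / 2) * (A ^ (4 / (2 + α)) * η * J ^ u) ≤
      l * (p + C + E * ps ^ (u / v)) := by
    calc (1 + α / 2) * (A ^ (4 / (2 + α)) * η * J ^ u)
        ≤ (1 + α / 2) * (A ^ (4 / (2 + α)) * (M * l) * (p ^ (u / v) + ps ^ (u / v))) := by
          gcongr
      _ = l * (E * p ^ (u / v) + E * ps ^ (u / v)) := by rw [hE]; ring
      _ ≤ _ := by
          have := hC p hp
          gcongr
  rw [div_mul_eq_mul_div, le_div_iff₀ (by positivity)]
  have h1 : 0 ≤ (C + E * ps ^ (u / v) + ps) * Γ := by positivity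
  nlinarith

/-! ### The empirical norm, its nets, and the empirical process over the cone. -/

namespace MBS

/-- A finite infimum in `ℕ∞` is attained, so the entropy bound gives an actual net without loss;
comparison with the infimum plus one extracts it. -/
theorem exists_finset_of_entropy_le {X : Type*} {n : ℕ} {x : Fin n → X} {δ e : ℝ}
    {G : Set (X → ℝ)} (h : entropy δ G x ≤ (e : EReal)) :
    ∃ T : Finset (X → ℝ), (T.card : ℝ) ≤ Real.exp e ∧
      ∀ g ∈ G, ∃ h ∈ T, empNorm x (g - h) ≤ δ := by
  have h1 : (coveringNumber δ G x : ENNReal) ≤ ENNReal.ofReal (Real.exp e) := by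
    rw [← ENNReal.log_le_log_iff, ENNReal.log_ofReal_of_pos (Real.exp_pos e), Real.log_exp]
    exact h
  have hne : coveringNumber δ G x ≠ ⊤ := by
    intro htop
    rw [htop] at h1
    simp at h1
  have hlt : coveringNumber δ G x < coveringNumber δ G x + 1 :=
    (ENat.lt_add_one_iff hne).2 le_rfl
  conv_lhs at hlt => rw [coveringNumber]
  simp only [iInf_lt_iff] at hlt
  obtain ⟨T, hT, hlt⟩ := hlt
  have hle : (T.card : ℕ∞) ≤ coveringNumber δ G x := (ENat.lt_add_one_iff hne).1 hlt
  refine ⟨T, ?_, hT⟩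
  have h2 : ((T.card : ℕ∞) : ENNReal) ≤ ENNReal.ofReal (Real.exp e) :=
    (ENat.toENNReal_le.2 hle).trans h1
  rw [ENat.toENNReal_coe, ← ENNReal.ofReal_natCast,
    ENNReal.ofReal_le_ofReal_iff (Real.exp_pos e).le] at h2
  exact h2

/-- Evaluation at the design points, scaled so that the Euclidean norm is the `L₂(Q_n)`-norm. -/
noncomputable def empVec {X : Type*} {n : ℕ} (x : Fin n → X) :
    (X → ℝ) →ₗ[ℝ] EuclideanSpace ℝ (Fin n) where
  toFun g := WithLp.toLp 2 fun i => g (x i) / Real.sqrt n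
  map_add' f g := by ext i; simp [add_div]
  map_smul' t g := by ext i; simp [mul_div_assoc]

theorem empVec_apply {X : Type*} {n : ℕ} (x : Fin n → X) (g : X → ℝ) (i : Fin n) :
    empVec x g i = g (x i) / Real.sqrt n := rfl

theorem empNormSq_nonneg {X : Type*} {n : ℕ} (x : Fin n → X) (g : X → ℝ) :
    0 ≤ empNormSq x g :=
  mul_nonneg (by positivity) (Finset.sum_nonneg fun _ _ => sq_nonneg _)

theorem norm_empVec_sq {X : Type*} {n : ℕ} (x : Fin n → X) (g : X → ℝ) :
    ‖empVec x g‖ ^ 2 = empNormSq x g := by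
  rw [EuclideanSpace.real_norm_sq_eq, empNormSq, Finset.mul_sum]
  refine Finset.sum_congr rfl fun i _ => ?_
  rw [empVec_apply, div_pow, Real.sq_sqrt (Nat.cast_nonneg n)]
  ring

theorem norm_empVec {X : Type*} {n : ℕ} (x : Fin n → X) (g : X → ℝ) :
    ‖empVec x g‖ = empNorm x g := by
  rw [empNorm, ← norm_empVec_sq, Real.sqrt_sq (norm_nonneg _)]

theorem IsPenalty.smul_le_one {X : Type*} {F : Set (X → ℝ)} {P : (X → ℝ) → ℝ} {v : ℝ}
    (hP : IsPenalty F P v) (hv : 0 < v) {f : X → ℝ} (hf : f ∈ F) {J : ℝ} (hJ : 0 < J)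
    (hle : P f ^ (1 / v) ≤ J) : P (J⁻¹ • f) ≤ 1 := by
  rw [hP.smul f hf _ (inv_pos.2 hJ), Real.inv_rpow hJ.le, inv_mul_le_one₀ (by positivity)]
  calc P f = (P f ^ (1 / v)) ^ v := by
        rw [← Real.rpow_mul (hP.nonneg f hf), one_div_mul_cancel hv.ne', Real.rpow_one]
    _ ≤ J ^ v := Real.rpow_le_rpow (Real.rpow_nonneg (hP.nonneg f hf) _) hle hv.le

/-- A cone with polynomial entropy is bounded: its unit sublevel set and the half of it lie in the
same ball. -/
theorem norm_empVec_le_of_entropy {X : Type*} {F : Set (X → ℝ)} {P : (X → ℝ) → ℝ} {α v c : ℝ}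
    (hα0 : 0 < α) (hv : 0 < v) (hF : IsCone F) (hP : IsPenalty F P v) (hc : 0 < c)
    {n : ℕ} {x : Fin n → X}
    (hent : ∀ δ : ℝ, 0 < δ → entropy δ {f | f ∈ F ∧ P f ≤ 1} x ≤ ((c * δ ^ (-α) : ℝ) : EReal))
    {f : X → ℝ} (hf : f ∈ F) (hPf : P f ≤ 1) :
    ‖empVec x f‖ ≤ 4 * (2 * c) ^ (1 / α) := by
  -- At this radius the entropy bound is `1/2`, and `exp (1/2) < 2` leaves room for one ball only.
  set R := (2 * c) ^ (1 / α) with hR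
  have hR0 : 0 < R := by positivity
  have hRα : c * R ^ (-α) = 1 / 2 := by
    rw [hR, ← Real.rpow_mul (by positivity), mul_neg, one_div_mul_cancel hα0.ne',
      Real.rpow_neg_one]
    field_simp
  have h := hent R hR0
  rw [hRα] at h
  obtain ⟨T, hT, hcov⟩ := exists_finset_of_entropy_le h
  have hcard : T.card ≤ 1 := by
    have h2 : Real.exp (1 / 2) < 2 := by
      have h3 : Real.exp (1 / 2) ^ 2 = Real.exp 1 := by rw [← Real.exp_nat_mul]; norm_num
      have := Real.exp_one_lt_d9
      by_contra hcon
      nlinarith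
    have : (T.card : ℝ) < 2 := hT.trans_lt h2
    have : T.card < 2 := by exact_mod_cast this
    omega
  have hhalf : P ((1 / 2 : ℝ) • f) ≤ 1 := by
    rw [hP.smul f hf _ (by norm_num)]
    exact mul_le_one₀ (Real.rpow_le_one (by norm_num) (by norm_num) hv.le) (hP.nonneg f hf) hPf
  obtain ⟨h1, hh1, hd1⟩ := hcov f ⟨hf, hPf⟩
  obtain ⟨h2, hh2, hd2⟩ := hcov _ ⟨hF f hf (1 / 2) (by norm_num), hhalf⟩
  obtain rfl := Finset.card_le_one.1 hcard _ hh1 _ hh2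
  rw [← norm_empVec] at hd1 hd2
  -- Both `f` and `f/2` are within `R` of the single centre, so `f/2` has norm at most `2R`.
  have e : empVec x f = (2 : ℝ) • (empVec x (f - h1) - empVec x ((1 / 2 : ℝ) • f - h1)) := by
    rw [← map_sub, ← map_smul]
    congr 1
    module
  rw [e, norm_smul, Real.norm_eq_abs, abs_two]
  linarith [norm_sub_le (empVec x (f - h1)) (empVec x ((1 / 2 : ℝ) • f - h1))]

/-- Differences of points of a `δ/2`-net form a `δ`-net of the differences. Squaring the cardinality
doubles the entropy and halving the radius gives `(1/2)^(-α)`. Differences are needed because `f -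
f*` need not lie in the cone. -/
theorem exists_net_empVec_sub {X : Type*} {G : Set (X → ℝ)} {α c : ℝ} {n : ℕ} {x : Fin n → X}
    (hent : ∀ δ : ℝ, 0 < δ → entropy δ G x ≤ ((c * δ ^ (-α) : ℝ) : EReal))
    {δ : ℝ} (hδ : 0 < δ) :
    ∃ T : Finset (EuclideanSpace ℝ (Fin n)),
      (T.card : ℝ) ≤ Real.exp (2 * c * (1 / 2) ^ (-α) * δ ^ (-α)) ∧
      ∀ g ∈ {a | ∃ f ∈ G, ∃ f' ∈ G, a = empVec x (f - f')}, ∃ h ∈ T, ‖g - h‖ ≤ δ := by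
  classical
  obtain ⟨T, hT, hcov⟩ := exists_finset_of_entropy_le (hent (1 / 2 * δ) (by positivity))
  refine ⟨(T ×ˢ T).image fun p => empVec x (p.1 - p.2), ?_, ?_⟩
  · calc (((T ×ˢ T).image fun p => empVec x (p.1 - p.2)).card : ℝ) ≤ (T ×ˢ T).card := by
          exact_mod_cast Finset.card_image_le
      _ = (T.card : ℝ) * T.card := by rw [Finset.card_product]; push_cast; ring
      _ ≤ Real.exp (c * (1 / 2 * δ) ^ (-α)) * Real.exp (c * (1 / 2 * δ) ^ (-α)) := by gcongr
      _ = _ := by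
          rw [← Real.exp_add, Real.mul_rpow (by norm_num) hδ.le]
          ring_nf
  · rintro _ ⟨f, hf, f', hf', rfl⟩
    obtain ⟨h, hh, hd⟩ := hcov f hf
    obtain ⟨h', hh', hd'⟩ := hcov f' hf'
    refine ⟨_, Finset.mem_image.2 ⟨(h, h'), Finset.mem_product.2 ⟨hh, hh'⟩, rfl⟩, ?_⟩
    rw [← norm_empVec] at hd hd'
    have e : empVec x (f - f') - empVec x (h - h') = empVec x (f - h) - empVec x (f' - h') := by
      rw [← map_sub, ← map_sub]
      congr 1
      abel
    rw [e]
    linarith [norm_sub_le (empVec x (f - h)) (empVec x (f' - h'))]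

/-- Weighted modulus of continuity of the empirical process indexed by a cone of functions. -/
theorem exists_const_empirical_process_le {Ω : Type*} [MeasurableSpace Ω] (μ : Measure Ω)
    [IsProbabilityMeasure μ] {X : Type*} {F : Set (X → ℝ)} {P : (X → ℝ) → ℝ} {fstar : X → ℝ}
    {α v c K σ₀ : ℝ} (hα0 : 0 < α) (hα2 : α < 2) (hv : 0 < v)
    (hF : IsCone F) (hP : IsPenalty F P v) (hfstar : fstar ∈ F) (hPfstar : 0 < P fstar)
    (x : (n : ℕ) → Fin n → X) (hc : 0 < c)
    (hentropy : ∀ n : ℕ, 1 ≤ n → ∀ δ : ℝ, 0 < δ →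
      entropy δ {f | f ∈ F ∧ P f ≤ 1} (x n) ≤ ((c * δ ^ (-α) : ℝ) : EReal))
    (hK : 0 < K) (w : (n : ℕ) → Fin n → Ω → ℝ) (hw : IsSubGaussianErrors μ w K σ₀)
    {ε : ℝ} (hε : 0 < ε) :
    ∃ A : ℝ, 0 < A ∧ ∀ n : ℕ, 1 ≤ n → μ {ω | ∃ f ∈ F,
      A * ‖empVec (x n) (f - fstar)‖ ^ (1 - α / 2) *
        (P f ^ (1 / v) + P fstar ^ (1 / v)) ^ (α / 2) <
      |∑ i, empVec (x n) (f - fstar) i * w n i ω|} ≤ ENNReal.ofReal ε := by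
  have hs : 0 < K ^ 2 / 2 + 2 * σ₀ ^ 2 := by positivity
  obtain ⟨A, hA, h⟩ := exists_const_measure_modulus_le μ (C := 2 * c * (1 / 2) ^ (-α))
    (R := 8 * (2 * c) ^ (1 / α)) hα0 hα2 (by positivity) (by positivity) hs hε
  refine ⟨A, hA, fun n hn => ?_⟩
  have hsub : ∀ i, HasSubgaussianMGF (w n i) (Real.toNNReal (K ^ 2 / 2 + 2 * σ₀ ^ 2)) μ := fun i =>
    hasSubgaussianMGF_of_integral_exp_sq (hw.measurable n i) hK (hw.mean_zero n i)
      (hw.integrable_exp n i) (hw.subGaussian n i)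
  set Z : Ω → EuclideanSpace ℝ (Fin n) →L[ℝ] ℝ :=
    fun ω => innerSL ℝ (WithLp.toLp 2 fun i => w n i ω) with hZ
  have hZa : ∀ ω a, Z ω a = ∑ i, a i * w n i ω := fun ω a => by
    simp [hZ, PiLp.inner_apply]
  refine (measure_mono ?_).trans (h (EuclideanSpace ℝ (Fin n)) Z
    {a | ∃ f ∈ {f | f ∈ F ∧ P f ≤ 1}, ∃ f' ∈ {f | f ∈ F ∧ P f ≤ 1}, a = empVec (x n) (f - f')}
    ?_ (fun δ hδ => exists_net_empVec_sub (hentropy n hn) hδ) fun a t ht => ?_)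
  · rintro ω ⟨f, hf, hlt⟩
    have hb0 : 0 < P fstar ^ (1 / v) := by positivity
    have ha0 : 0 ≤ P f ^ (1 / v) := Real.rpow_nonneg (hP.nonneg f hf) _
    -- `J` dominates both summands, so `f / J` and `f* / J` have penalty at most one; `P f* > 0`
    -- makes `J` positive. Undoing the scaling in the modulus bound leaves the factor `J^(α/2)`.
    set J := P f ^ (1 / v) + P fstar ^ (1 / v) with hJ
    have hJ0 : 0 < J := by positivity
    refine ⟨empVec (x n) (J⁻¹ • f - J⁻¹ • fstar),
      ⟨_, ⟨hF f hf _ (inv_pos.2 hJ0), hP.smul_le_one hv hf hJ0 (by linarith)⟩,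
        _, ⟨hF fstar hfstar _ (inv_pos.2 hJ0), hP.smul_le_one hv hfstar hJ0 (by linarith)⟩, rfl⟩,
      ?_⟩
    rw [← smul_sub, map_smul, map_smul, hZa, norm_smul, smul_eq_mul, abs_mul, Real.norm_eq_abs,
      abs_of_pos (inv_pos.2 hJ0), Real.mul_rpow (inv_pos.2 hJ0).le (norm_nonneg _)]
    have e : J⁻¹ * J ^ (α / 2) = J⁻¹ ^ (1 - α / 2) := by
      rw [Real.inv_rpow hJ0.le, ← Real.rpow_neg hJ0.le, ← Real.rpow_neg_one,
        ← Real.rpow_add hJ0]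
      congr 1
      ring
    rw [← e]
    calc _ = J⁻¹ * (A * ‖empVec (x n) (f - fstar)‖ ^ (1 - α / 2) * J ^ (α / 2)) := by ring
      _ < _ := mul_lt_mul_of_pos_left hlt (inv_pos.2 hJ0)
  · rintro _ ⟨f, ⟨hf, hPf⟩, f', ⟨hf', hPf'⟩, rfl⟩
    rw [map_sub]
    have h1 := norm_empVec_le_of_entropy hα0 hv hF hP hc (hentropy n hn) hf hPf
    have h2 := norm_empVec_le_of_entropy hα0 hv hF hP hc (hentropy n hn) hf' hPf'
    linarith [norm_sub_le (empVec (x n) f) (empVec (x n) f')]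
  · simp only [hZa]
    exact measure_inner_tail_le_of_iIndepFun (hw.indep n) hs hsub a ht

/-! ### Calculus of stochastic order. -/

theorem IsBigOP.trans {Ω : Type*} [MeasurableSpace Ω] {μ : Measure Ω} {a b d : ℕ → Ω → ℝ}
    (hab : IsBigOP μ a b) (hbd : IsBigOP μ b d) : IsBigOP μ a d := by
  intro ε hε
  obtain ⟨M, hM, h1⟩ := hab (ε / 2) (by positivity)
  obtain ⟨N, hN, h2⟩ := hbd (ε / 2) (by positivity)
  refine ⟨M * N, by positivity, ?_⟩
  filter_upwards [h1, h2] with n h1 h2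
  have hsub : {ω | M * N * |d n ω| < |a n ω|} ⊆
      {ω | M * |b n ω| < |a n ω|} ∪ {ω | N * |d n ω| < |b n ω|} := by
    intro ω hω
    by_contra hcon
    simp only [Set.mem_union, Set.mem_ofPred_eq, not_or, not_lt] at hcon hω
    nlinarith [mul_le_mul_of_nonneg_left hcon.2 hM.le]
  calc _ ≤ _ := measure_mono hsub
    _ ≤ _ := measure_union_le _ _
    _ ≤ ENNReal.ofReal (ε / 2) + ENNReal.ofReal (ε / 2) := add_le_add h1 h2
    _ = ENNReal.ofReal ε := by
        rw [← ENNReal.ofReal_add (by positivity) (by positivity), add_halves]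

theorem IsBigOP.add_const_mul {Ω : Type*} [MeasurableSpace Ω] {μ : Measure Ω}
    {a b : ℕ → Ω → ℝ} (h : IsBigOP μ a b) (t : ℝ) :
    IsBigOP μ (fun n ω => b n ω + t * a n ω) b := by
  intro ε hε
  obtain ⟨M, hM, h1⟩ := h ε hε
  refine ⟨1 + |t| * M, by positivity, ?_⟩
  filter_upwards [h1] with n h1
  refine (measure_mono fun ω hω => ?_).trans h1
  by_contra hcon
  simp only [Set.mem_ofPred_eq, not_lt] at hcon hω
  have h2 := abs_add_le (b n ω) (t * a n ω)
  rw [abs_mul] at h2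
  nlinarith [mul_le_mul_of_nonneg_left hcon (abs_nonneg t)]

/-- The basic inequality of penalized least squares. -/
theorem basic_inequality {X : Type*} {n : ℕ} {x : Fin n → X} {y e : Fin n → ℝ}
    {fstar f : X → ℝ} {l Γ : ℝ} {P : (X → ℝ) → ℝ} (hy : ∀ i, y i = fstar (x i) + e i)
    (h : penLoss x y l P f ≤ penLoss x y l P fstar + Γ) :
    ‖empVec x (f - fstar)‖ ^ 2 + l * P f ≤
      2 * ((Real.sqrt n)⁻¹ * ∑ i, empVec x (f - fstar) i * e i) + l * P fstar + Γ := by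
  have e1 : (1 / (n : ℝ)) * ∑ i, (y i - f (x i)) ^ 2 =
      ‖empVec x (f - fstar)‖ ^ 2 - 2 * ((Real.sqrt n)⁻¹ * ∑ i, empVec x (f - fstar) i * e i) +
        (1 / (n : ℝ)) * ∑ i, (y i - fstar (x i)) ^ 2 := by
    rw [norm_empVec_sq, empNormSq, Finset.mul_sum, Finset.mul_sum, Finset.mul_sum,
      Finset.mul_sum, Finset.mul_sum, ← Finset.sum_sub_distrib, ← Finset.sum_add_distrib]
    refine Finset.sum_congr rfl fun i _ => ?_
    have e2 : (1 / (n : ℝ)) = (Real.sqrt n)⁻¹ * (Real.sqrt n)⁻¹ := by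
      rw [← mul_inv, Real.mul_self_sqrt (Nat.cast_nonneg n), one_div]
    rw [empVec_apply, hy, e2, Pi.sub_apply]
    ring
  rw [penLoss, penLoss, e1] at h
  linarith

end MBS

/-! ### The rate of convergence. -/

theorem theorem1
    {Ω : Type*} [MeasurableSpace Ω] (μ : Measure Ω) [IsProbabilityMeasure μ]
    {X : Type*}
    -- the function class, the penalty and the true function
    (F : Set (X → ℝ)) (P : (X → ℝ) → ℝ) (fstar : X → ℝ)
    (α v c K σ₀ : ℝ) (hα0 : 0 < α) (hα2 : α < 2) (hv : 2 * α / (2 + α) < v)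
    (hF : MBS.IsCone F) (hP : MBS.IsPenalty F P v)
    (hfstar : fstar ∈ F) (hPfstar : 0 < P fstar)
    -- the design points, with the entropy bound for their empirical measures
    (x : (n : ℕ) → Fin n → X) (hc : 0 < c)
    (hentropy : ∀ n : ℕ, 1 ≤ n → ∀ δ : ℝ, 0 < δ →
      MBS.entropy δ {f | f ∈ F ∧ P f ≤ 1} (x n) ≤ ((c * δ ^ (-α) : ℝ) : EReal))
    -- the errors and the responses
    (hK : 0 < K) (w : (n : ℕ) → Fin n → Ω → ℝ) (hw : MBS.IsSubGaussianErrors μ w K σ₀)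
    (y : (n : ℕ) → Ω → Fin n → ℝ) (hy : ∀ n ω i, y n ω i = fstar (x n i) + w n i ω)
    -- the tuning parameter, which may depend on the data
    (lam : ℕ → Ω → ℝ) (hlam0 : ∀ n ω, 0 ≤ lam n ω)
    (hlam : MBS.IsBigOP μ (fun n _ => (n : ℝ) ^ (-(2 / (2 + α)))) lam)
    -- the penalized least squares estimator
    (fhat : ℕ → Ω → X → ℝ)
    (hfhat : ∀ n : ℕ, 1 ≤ n → ∀ᵐ ω ∂μ, fhat n ω ∈ F ∧
      IsMinOn (MBS.penLoss (x n) (y n ω) (lam n ω) P) F (fhat n ω))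
    -- the mesh based solution: interpolator, discretized penalty, minimizer
    (m : ℕ → ℕ) (interp : (n : ℕ) → (Fin (m n) → ℝ) → (X → ℝ))
    (hinterp : ∀ n θ, interp n θ ∈ F)
    (PD : (n : ℕ) → (Fin (m n) → ℝ) → ℝ)
    (fD : (n : ℕ) → Ω → Fin (m n) → ℝ)
    (hfD : ∀ n : ℕ, 1 ≤ n → ∀ᵐ ω ∂μ,
      IsMinOn (MBS.meshLoss (x n) (y n ω) (lam n ω) (interp n) (PD n)) Set.univ (fD n ω))
    -- its excess loss
    (Γ : ℕ → Ω → ℝ)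
    (hΓ : ∀ n : ℕ, 1 ≤ n → ∀ᵐ ω ∂μ,
      MBS.penLoss (x n) (y n ω) (lam n ω) P (interp n (fD n ω)) ≤
        MBS.penLoss (x n) (y n ω) (lam n ω) P (fhat n ω) + Γ n ω) :
    MBS.IsBigOP μ (fun n ω => MBS.empNormSq (x n) (interp n (fD n ω) - fstar))
        (fun n ω => lam n ω + 6 * Γ n ω) ∧
      (MBS.IsBigOP μ Γ lam →
        MBS.IsBigOP μ (fun n ω => MBS.empNormSq (x n) (interp n (fD n ω) - fstar)) lam ∧
        (MBS.IsBigOP μ lam (fun n _ => (n : ℝ) ^ (-(2 / (2 + α)))) →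
          MBS.IsBigOP μ (fun n ω => MBS.empNormSq (x n) (interp n (fD n ω) - fstar))
            (fun n _ => (n : ℝ) ^ (-(2 / (2 + α)))))) := by
  have hu0 : 0 < 2 * α / (2 + α) := by positivity
  have hv0 : 0 < v := hu0.trans hv
  have hmain : MBS.IsBigOP μ (fun n ω => MBS.empNormSq (x n) (interp n (fD n ω) - fstar))
      (fun n ω => lam n ω + 6 * Γ n ω) := by
    intro ε hε
    obtain ⟨M, hM, hM1⟩ := hlam (ε / 2) (by positivity)
    obtain ⟨A, hA, hA1⟩ := MBS.exists_const_empirical_process_le μ hα0 hα2 hv0 hF hP hfstar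
      hPfstar x hc hentropy hK w hw (ε := ε / 2) (by positivity)
    obtain ⟨B, hB, hB1⟩ := exists_const_sq_le_of_basic_inequality hα0 hα2 hv hA.le hM.le
      hPfstar.le
    refine ⟨B, hB, ?_⟩
    filter_upwards [hM1, eventually_ge_atTop 1] with n hn1 hn
    set S₁ := {ω | M * |lam n ω| < |(n : ℝ) ^ (-(2 / (2 + α)))|} with hS₁
    set S₂ := {ω | ∃ f ∈ F, A * ‖MBS.empVec (x n) (f - fstar)‖ ^ (1 - α / 2) *
        (P f ^ (1 / v) + P fstar ^ (1 / v)) ^ (α / 2) <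
      |∑ i, MBS.empVec (x n) (f - fstar) i * w n i ω|} with hS₂
    -- Off the two bad events the bound is deterministic. The inclusion holds only up to a null set,
    -- since minimality and the excess bound hold almost surely.
    have hae : ({ω | B * |lam n ω + 6 * Γ n ω| <
        |MBS.empNormSq (x n) (interp n (fD n ω) - fstar)|} : Set Ω) ≤ᵐ[μ] (S₁ ∪ S₂ : Set Ω) := by
      filter_upwards [hfhat n hn, hΓ n hn] with ω hω hΓω
      change B * |lam n ω + 6 * Γ n ω| < |MBS.empNormSq (x n) (interp n (fD n ω) - fstar)| →
        ω ∈ S₁ ∪ S₂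
      intro hlt
      by_contra hcon
      rw [Set.mem_union, not_or] at hcon
      obtain ⟨hc1, hc2⟩ := hcon
      simp only [hS₁, Set.mem_ofPred_eq, not_lt] at hc1
      simp only [hS₂, Set.mem_ofPred_eq, not_exists, not_and, not_lt] at hc2
      set f := interp n (fD n ω) with hf
      have hfF : f ∈ F := hinterp n _
      -- The interpolant competes in the minimization over `F`, so the excess is nonnegative; hence
      -- `λ + Γ ≤ λ + 6Γ` and the absolute value is harmless.
      have hΓ0 : 0 ≤ Γ n ω := by
        have : MBS.penLoss (x n) (y n ω) (lam n ω) P (fhat n ω) ≤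
          MBS.penLoss (x n) (y n ω) (lam n ω) P f := hω.2 hfF
        linarith
      have hl0 := hlam0 n ω
      have hstar : MBS.penLoss (x n) (y n ω) (lam n ω) P (fhat n ω) ≤
        MBS.penLoss (x n) (y n ω) (lam n ω) P fstar := hω.2 hfstar
      have hbasic := MBS.basic_inequality (e := fun i => w n i ω) (hy n ω)
        (hΓω.trans (add_le_add_left hstar _))
      rw [abs_of_nonneg hl0, abs_of_nonneg (by positivity)] at hc1
      -- The rate `n^(-2/(2+α))` is the `η` for which `η^((2+α)/4)` equals the noise scale
      -- `n^(-1/2)`.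
      have hpow : ((n : ℝ) ^ (-(2 / (2 + α)))) ^ ((2 + α) / 4) = (Real.sqrt n)⁻¹ := by
        rw [← Real.rpow_mul (Nat.cast_nonneg n), Real.sqrt_eq_rpow,
          ← Real.rpow_neg (Nat.cast_nonneg n)]
        congr 1
        field_simp
        norm_num
      have hbound := hB1 ‖MBS.empVec (x n) (f - fstar)‖ (P f) (lam n ω)
        ((n : ℝ) ^ (-(2 / (2 + α)))) (Γ n ω) (norm_nonneg _) (hP.nonneg f hfF) hl0
        (by positivity) hΓ0 hc1 (by
          refine hbasic.trans ?_
          rw [hpow]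
          have h1 := (le_abs_self _).trans (hc2 f hfF)
          have h2 := mul_le_mul_of_nonneg_left h1
            (inv_nonneg.2 (Real.sqrt_nonneg (n : ℝ)))
          linarith)
      rw [MBS.norm_empVec_sq] at hbound
      rw [abs_of_nonneg (MBS.empNormSq_nonneg _ _), abs_of_nonneg (by positivity)] at hlt
      nlinarith
    calc _ ≤ μ (S₁ ∪ S₂) := measure_mono_ae hae
      _ ≤ μ S₁ + μ S₂ := measure_union_le _ _
      _ ≤ ENNReal.ofReal (ε / 2) + ENNReal.ofReal (ε / 2) := add_le_add hn1 (hA1 n hn)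
      _ = ENNReal.ofReal ε := by
          rw [← ENNReal.ofReal_add (by positivity) (by positivity), add_halves]
  exact ⟨hmain, fun hΓlam => ⟨hmain.trans (hΓlam.add_const_mul 6),
    fun hlamn => (hmain.trans (hΓlam.add_const_mul 6)).trans hlamn⟩⟩
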